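/- A \emph{Bayesian game} $\Gamma=(P,T,q,A,U)$ has a finite set $P$ of players, type sets $T_i$, a prior distribution $q$ on $T=\prod_i T_i$ (types may be correlated) under which every type of every player has positive probability (so each $T_i$ is countable), action sets $A_i$ (finite or infinite) each equipped with a $\sigma$-algebra, $A=\prod_i A_i$, and utilities $u_i:T_i\times A\to\mathbb R$ that are measurable in the action profile. A strategy $\sigma_i$ of player $i$ maps each $t_i\in T_i$ to a probability measure on $A_i$; $u_i(\vec\sigma)$ is the expected utility when types are drawn from $q$ and then players draw their actions independently according to $\vec\sigma$. The game is \emph{bounded} if all $u_i$ are bounded. A profile $\vec\sigma$ is a \emph{Nash equilibrium} if $u_i(\vec\sigma)\ge u_i(\vec\sigma_{-i},\tau_i)$ for all $i$ and all strategies $\tau_i$. It is a \emph{semi-strong Nash equilibrium} if for every nonempty $S\subseteq P$ and every $\vec\tau_S$ there are $i\in S$ and a strategy $\tau_i'$ of $i$ with $u_i(\vec\sigma)\ge u_i(\vec\sigma_{-S},\vec\tau_S)$ or $u_i(\vec\sigma_{-S},\vec\tau_{S\setminus\{i\}},\tau_i')>u_i(\vec\sigma_{-S},\vec\tau_S)$.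 A profile $\vec\sigma$ \emph{quasi Pareto-dominates} $\vec\tau$ if $\sum_{i\in S}u_i(\vec\sigma)\ge\sum_{i\in S}u_i(\vec\tau)$ for all $S\subseteq P$ with $|S|\ge 2$. An \emph{extension} of $\Gamma$ is a game with the same $P,T,q$, with action sets $A_i'\supseteq A_i$ (where $A_i$ is a measurable subset of $A_i'$ carrying the induced $\sigma$-algebra), and with utilities that agree with $u_i$ on $T_i\times A$; profiles of $\Gamma$ are viewed as profiles of the extension that play new actions with probability $0$. \textbf{Theorem.} Let $\Gamma=(P,T,q,A,U)$ be a bounded Bayesian game and let $\vec\sigma$ be a Nash equilibrium of $\Gamma$. Then there is a bounded extension $\Gamma^{\vec\sigma}=(P,T,q,A^{\vec\sigma},U^{\vec\sigma})$ of $\Gamma$ such that: (a) $\vec\sigma$ is a Nash equilibrium and a semi-strong Nash equilibrium of $\Gamma^{\vec\sigma}$; (b) $\vec\sigma$ quasi Pareto-dominates every Nash equilibrium of $\Gamma^{\vec\sigma}$. Moreover, if $A$ is finite, then $\Gamma^{\vec\sigma}$ can be chosen such that in addition $|A_i^{\vec\sigma}|=|A_i|+|A|$ for all $i\in P$, and such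 that, if every subset of each $A_i$ is measurable, then every subset of each $A_i^{\vec\sigma}$ is measurable. -/

import Mathlib

open MeasureTheory

universe u v w

/-- A Bayesian game with finite player set `P`, type sets `T i` and action sets `A i`, each action
set carrying a σ-algebra. The prior over type profiles is an arbitrary (possibly correlated)
distribution under which every type of every player has positive probability; in particular every
`T i` is countable, so that nothing is lost by taking the prior to be discrete. The utility of a
player depends on its own type and on the action profile. -/
structure BayesianGame (P : Type v) [Fintype P] (T : P → Type w) (A : P → Type u)
    [∀ i, MeasurableSpace (A i)] where
  prior : PMF (∀ i, T i)
  prior_pos : ∀ (i : P) (t : T i), ∃ θ : ∀ j, T j, θ i = t ∧ 0 < prior θ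
  utility : ∀ i : P, T i → (∀ j, A j) → ℝ
  measurable_utility : ∀ (i : P) (t : T i), Measurable (utility i t)

namespace BayesianGame

variable {P : Type v} [Fintype P] {T : P → Type w} {A : P → Type u} [∀ i, MeasurableSpace (A i)]

/-- All utility functions are bounded. -/
def IsBounded (Γ : BayesianGame P T A) : Prop :=
  ∀ i : P, ∃ M : ℝ, ∀ (t : T i) (a : ∀ j, A j), |Γ.utility i t a| ≤ M

/-- A (mixed) strategy of player `i`: for each type, a distribution over the actions of `i`. -/
abbrev Strategy (_Γ : BayesianGame P T A) (i : P) : Type (max u w) :=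
  T i → ProbabilityMeasure (A i)

/-- A strategy profile: one strategy for each player. -/
abbrev Profile (Γ : BayesianGame P T A) : Type (max u v w) :=
  ∀ i : P, Γ.Strategy i

/-- The expected utility `u_i(σ)`: a type profile `θ` is drawn from the prior, and then each player
`j` draws its action, independently of the others, from `σ j (θ j)`. -/
noncomputable def expectedUtility (Γ : BayesianGame P T A) (σ : Γ.Profile) (i : P) : ℝ :=
  ∑' θ : ∀ j, T j, (Γ.prior θ).toReal *
    ∫ a, Γ.utility i (θ i) a ∂(Measure.pi fun j => (σ j (θ j) : Measure (A j)))

section Equilibria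

variable [DecidableEq P]

/-- No player can increase its expected utility by switching to another strategy. -/
def IsNash (Γ : BayesianGame P T A) (σ : Γ.Profile) : Prop :=
  ∀ (i : P) (τ : Γ.Strategy i),
    Γ.expectedUtility (Function.update σ i τ) i ≤ Γ.expectedUtility σ i

/-- For every (nonempty) coalition `S` and every joint deviation of `S` (only the components in `S`
of `τ` are used), some member of `S` either does not strictly gain from the deviation, or has a
strategy that is strictly better for it than its part of the deviation. -/
def IsSemiStrongNash (Γ : BayesianGame P T A) (σ : Γ.Profile) : Prop :=
  ∀ S : Finset P, S.Nonempty → ∀ τ : Γ.Profile, ∃ i ∈ S, ∃ τ' : Γ.Strategy i,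
    Γ.expectedUtility σ i ≥ Γ.expectedUtility (S.piecewise τ σ) i ∨
    Γ.expectedUtility (Function.update (S.piecewise τ σ) i τ') i >
      Γ.expectedUtility (S.piecewise τ σ) i

end Equilibria

/-- Every coalition with at least two members has at least as much total expected utility under `σ`
as under `τ`. -/
def QuasiParetoDominates (Γ : BayesianGame P T A) (σ τ : Γ.Profile) : Prop :=
  ∀ S : Finset P, 2 ≤ S.card →
    ∑ i ∈ S, Γ.expectedUtility σ i ≥ ∑ i ∈ S, Γ.expectedUtility τ i

/-- An extension of a game: a game with the same players, types and prior, whose action sets contain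
the original ones (as measurable subsets, with the original σ-algebra as the induced one), and whose
utilities agree with the original ones on the original action profiles. -/
structure Extension (Γ : BayesianGame P T A) where
  Action : P → Type u
  [measurableSpace : ∀ i, MeasurableSpace (Action i)]
  game : BayesianGame P T Action
  embed : ∀ i, A i → Action i
  measurableEmbedding_embed : ∀ i, MeasurableEmbedding (embed i)
  prior_eq : game.prior = Γ.prior
  utility_embed : ∀ (i : P) (t : T i) (a : ∀ j, A j),
    game.utility i t (fun j => embed j (a j)) = Γ.utility i t a

attribute [instance] Extension.measurableSpace

/-- A strategy profile of a game, viewed as a strategy profile of an extension: original actions are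
played with their original probabilities, and new actions with probability zero. -/
noncomputable def Extension.lift {Γ : BayesianGame P T A} (E : Γ.Extension) (σ : Γ.Profile) :
    E.game.Profile :=
  fun i t => (σ i t).map (E.measurableEmbedding_embed i).measurable.aemeasurable

end BayesianGame

/-!
Let `c i t x` be the utility that player `i` of type `t` expects from the action `x` against `σ`
(`condUtility`). In the extended game every action `x` of `i` gets new counterparts. They carry out
`x`, but add to the utility `u` of `i` the surplus `u - c i t x`, provided that all opponents play
original actions. If some opponent plays a new action, then `i` gets `-5 * M` instead, where `M`
bounds all utilities. One counterpart for each action would suffice; indexing them by the action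
profiles with component `x` at `i` yields the required number of actions.

Against `σ` the surplus has mean zero, so new actions bring nothing, and `σ` remains a Nash
equilibrium (`expectedUtility_update_liftInl`, `isNash_extGame`). Now let `ρ` be any profile of the
extended game in which `i` cannot profit from a deviation. Switching from all original actions to
new counterparts does not pay, hence the surplus of `i` has nonpositive mean where `i` and all its
opponents play original actions. So `i` can exceed `u_i(σ)` only by playing new actions, and it loses
when opponents do: with `y_i` the probability that `i` plays a new action and `x_i` the probability
that some opponent of `i` does,
`u_i(ρ) ≤ u_i(σ) + 4 * M * (y_i - x_i)` (`expectedUtility_le_add`).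

For `i ≠ k` clearly `y_i ≤ x_k`, so that `∑ y_i ≤ ∑ x_i` over every coalition with at least two
members. If no member of the coalition can profit from a deviation, its total utility under `ρ` is
therefore at most that under `σ` (`sum_expectedUtility_le`). For Nash equilibria `ρ` this is quasi
Pareto-domination. For a joint deviation `ρ` of a coalition from `σ` it says that not all members
can gain strictly, which is the semi-strong equilibrium property; coalitions of one player are
covered by the Nash property.
-/

namespace BayesianGame

/-! ### Expectations of functions of the type profile and the action profile -/

section Expectation

variable {P : Type v} {T : P → Type w} {B : P → Type u} [∀ i, MeasurableSpace (B i)]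

/-- The functions whose expectation is meaningful under every profile: bounded, and measurable in
the action profile. -/
def IsAdmissible (f : (∀ j, T j) → (∀ j, B j) → ℝ) : Prop :=
  (∀ θ, Measurable (f θ)) ∧ ∃ M, ∀ θ a, |f θ a| ≤ M

variable {f g : (∀ j, T j) → (∀ j, B j) → ℝ}

lemma IsAdmissible.add (hf : IsAdmissible f) (hg : IsAdmissible g) :
    IsAdmissible fun θ a => f θ a + g θ a := by
  obtain ⟨hf, M, hM⟩ := hf
  obtain ⟨hg, N, hN⟩ := hg
  exact ⟨fun θ => (hf θ).add (hg θ), M + N, fun θ a =>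
    (abs_add_le _ _).trans (add_le_add (hM θ a) (hN θ a))⟩

lemma IsAdmissible.const_mul (hf : IsAdmissible f) (c : ℝ) :
    IsAdmissible fun θ a => c * f θ a := by
  obtain ⟨hf, M, hM⟩ := hf
  refine ⟨fun θ => (hf θ).const_mul c, |c| * M, fun θ a => ?_⟩
  rw [abs_mul]
  exact mul_le_mul_of_nonneg_left (hM θ a) (abs_nonneg c)

lemma IsAdmissible.sub (hf : IsAdmissible f) (hg : IsAdmissible g) :
    IsAdmissible fun θ a => f θ a - g θ a := by
  simpa [sub_eq_add_neg] using hf.add (hg.const_mul (-1))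

variable [Fintype P]

/-- The distribution of the action profile, given the type profile `θ`. -/
noncomputable abbrev actionLaw (τ : ∀ j, T j → ProbabilityMeasure (B j)) (θ : ∀ j, T j) :
    Measure (∀ j, B j) :=
  Measure.pi fun j => (τ j (θ j) : Measure (B j))

/-- The expectation of `f θ a`, where `θ` is drawn from `q` and then `a` from the strategy profile
`τ`. -/
noncomputable def expect (q : PMF (∀ j, T j)) (τ : ∀ j, T j → ProbabilityMeasure (B j))
    (f : (∀ j, T j) → (∀ j, B j) → ℝ) : ℝ :=
  ∑' θ, (q θ).toReal * ∫ a, f θ a ∂(actionLaw τ θ)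

variable {q : PMF (∀ j, T j)} {τ : ∀ j, T j → ProbabilityMeasure (B j)}

lemma summable_prior_mul {ι : Type*} (p : PMF ι) {h : ι → ℝ} {M : ℝ} (hM : ∀ x, |h x| ≤ M) :
    Summable fun x => (p x).toReal * h x := by
  refine Summable.of_norm_bounded
    (g := fun x => (p x).toReal * M)
    ((ENNReal.summable_toReal p.tsum_coe_ne_top).mul_right M) fun x => ?_
  rw [norm_mul, Real.norm_of_nonneg ENNReal.toReal_nonneg]
  exact mul_le_mul_of_nonneg_left (hM x) ENNReal.toReal_nonneg

lemma abs_integral_le_of_abs_le {Ω : Type*} [MeasurableSpace Ω] (μ : Measure Ω)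
    [IsProbabilityMeasure μ] {h : Ω → ℝ} {M : ℝ} (hM : ∀ x, |h x| ≤ M) : |∫ x, h x ∂μ| ≤ M := by
  simpa using norm_integral_le_of_norm_le_const (μ := μ) (f := h) (C := M)
    (Filter.Eventually.of_forall hM)

lemma integrable_of_abs_le {Ω : Type*} [MeasurableSpace Ω] (μ : Measure Ω)
    [IsProbabilityMeasure μ] {h : Ω → ℝ} (hm : Measurable h) {M : ℝ} (hM : ∀ x, |h x| ≤ M) :
    Integrable h μ :=
  Integrable.of_bound hm.aestronglyMeasurable M (Filter.Eventually.of_forall hM)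

lemma IsAdmissible.integrable (hf : IsAdmissible f) (θ : ∀ j, T j) :
    Integrable (f θ) (actionLaw τ θ) :=
  integrable_of_abs_le _ (hf.1 θ) (hf.2.choose_spec θ)

lemma IsAdmissible.summable (hf : IsAdmissible f) :
    Summable fun θ => (q θ).toReal * ∫ a, f θ a ∂(actionLaw τ θ) :=
  summable_prior_mul q fun θ => abs_integral_le_of_abs_le _ (hf.2.choose_spec θ)

lemma expect_add (hf : IsAdmissible f) (hg : IsAdmissible g) :
    expect q τ (fun θ a => f θ a + g θ a) = expect q τ f + expect q τ g := by
  unfold expect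
  rw [← hf.summable.tsum_add hg.summable]
  refine tsum_congr fun θ => ?_
  rw [integral_add (hf.integrable θ) (hg.integrable θ), mul_add]

lemma expect_const_mul (c : ℝ) :
    expect q τ (fun θ a => c * f θ a) = c * expect q τ f := by
  unfold expect
  rw [← tsum_mul_left]
  refine tsum_congr fun θ => ?_
  rw [integral_const_mul]
  ring

lemma expect_sub (hf : IsAdmissible f) (hg : IsAdmissible g) :
    expect q τ (fun θ a => f θ a - g θ a) = expect q τ f - expect q τ g := by
  have h := expect_add (q := q) (τ := τ) hf (hg.const_mul (-1))
  rw [expect_const_mul] at h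
  simpa [sub_eq_add_neg] using h

lemma expect_mono (hf : IsAdmissible f) (hg : IsAdmissible g) (h : ∀ θ a, f θ a ≤ g θ a) :
    expect q τ f ≤ expect q τ g :=
  hf.summable.tsum_le_tsum (fun θ => mul_le_mul_of_nonneg_left
    (integral_mono (hf.integrable θ) (hg.integrable θ) (h θ)) ENNReal.toReal_nonneg) hg.summable

variable {B' : P → Type u} [∀ i, MeasurableSpace (B' i)]

/-- Relabelling the actions of each player. -/
lemma integral_actionLaw_map {π : ∀ j, B j → B' j} (hπ : ∀ j, Measurable (π j)) (θ : ∀ j, T j)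
    {h : (∀ j, B' j) → ℝ} (hh : Measurable h) :
    ∫ a, h a ∂(actionLaw (fun j t => (τ j t).map (hπ j).aemeasurable) θ) =
      ∫ a, h (fun j => π j (a j)) ∂(actionLaw τ θ) := by
  have : actionLaw (fun j t => (τ j t).map (hπ j).aemeasurable) θ =
      (actionLaw τ θ).map fun a j => π j (a j) := by
    have : ∀ j, SigmaFinite ((τ j (θ j) : Measure (B j)).map (π j)) := fun j =>
      have := Measure.isProbabilityMeasure_map (μ := (τ j (θ j) : Measure (B j)))
        (hπ j).aemeasurable
      inferInstance
    exact (Measure.pi_map_pi fun j => (hπ j).aemeasurable).symm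
  have hm : Measurable fun (a : ∀ j, B j) j => π j (a j) :=
    measurable_pi_lambda _ fun j => (hπ j).comp (measurable_pi_apply j)
  rw [this, integral_map hm.aemeasurable hh.aestronglyMeasurable]

lemma expect_map {π : ∀ j, B j → B' j} (hπ : ∀ j, Measurable (π j))
    {h : (∀ j, T j) → (∀ j, B' j) → ℝ} (hh : ∀ θ, Measurable (h θ)) :
    expect q (fun j t => (τ j t).map (hπ j).aemeasurable) h =
      expect q τ fun θ a => h θ fun j => π j (a j) :=
  tsum_congr fun θ => by rw [integral_actionLaw_map hπ θ (hh θ)]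

variable [DecidableEq P]

lemma map_update_prod_pi (μ : ∀ j, Measure (B j)) [∀ j, IsProbabilityMeasure (μ j)] (i : P)
    (ν : Measure (B i)) [IsProbabilityMeasure ν] :
    (ν.prod (Measure.pi μ)).map (fun p => Function.update p.2 i p.1) =
      Measure.pi (Function.update μ i ν) := by
  have : ∀ j, IsProbabilityMeasure (Function.update μ i ν j) := by
    intro j
    rcases eq_or_ne j i with rfl | h
    · simpa
    · simpa [h] using (inferInstance : IsProbabilityMeasure (μ j))
  have hm : Measurable fun p : B i × (∀ j, B j) => Function.update p.2 i p.1 :=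
    measurable_update'.comp measurable_swap
  refine (Measure.pi_eq fun s hs => ?_).symm
  rw [Measure.map_apply hm (.univ_pi hs)]
  have : (fun p : B i × (∀ j, B j) => Function.update p.2 i p.1) ⁻¹' Set.univ.pi s =
      s i ×ˢ Set.univ.pi (Function.update s i Set.univ) := by
    ext p
    simp only [Set.mem_preimage, Set.mem_pi, Set.mem_univ, true_imp_iff, Set.mem_prod]
    constructor
    · intro h
      refine ⟨by simpa using h i, fun j => ?_⟩
      rcases eq_or_ne j i with rfl | hj
      · simp
      · simpa [hj] using h j
    · rintro ⟨h1, h2⟩ j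
      rcases eq_or_ne j i with rfl | hj
      · simpa using h1
      · simpa [hj] using h2 j
  rw [this, Measure.prod_prod, Measure.pi_pi, ← Finset.mul_prod_erase _ _ (Finset.mem_univ i),
    ← Finset.mul_prod_erase _ (fun j => Function.update μ i ν j (s j)) (Finset.mem_univ i)]
  simp only [Function.update_self, measure_univ, one_mul]
  congr 1
  refine Finset.prod_congr rfl fun j hj => ?_
  have hj := Finset.ne_of_mem_erase hj
  simp [hj]

/-- When `i` plays `ν`, its action can be drawn separately and substituted into the action profile
that results from any other strategy of `i`. -/
lemma integral_actionLaw_update (i : P) (ν : T i → ProbabilityMeasure (B i)) (θ : ∀ j, T j)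
    {h : (∀ j, B j) → ℝ} (hm : Measurable h) {M : ℝ} (hM : ∀ a, |h a| ≤ M) :
    ∫ a, h a ∂(actionLaw (Function.update τ i ν) θ) =
      ∫ x, ∫ b, h (Function.update b i x) ∂(actionLaw τ θ) ∂(ν (θ i) : Measure (B i)) := by
  have hu : Measurable fun p : B i × (∀ j, B j) => Function.update p.2 i p.1 :=
    measurable_update'.comp measurable_swap
  have : actionLaw (Function.update τ i ν) θ =
      ((ν (θ i) : Measure (B i)).prod (actionLaw τ θ)).map
        (fun p => Function.update p.2 i p.1) := by
    rw [map_update_prod_pi]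
    refine congrArg Measure.pi (funext fun j => ?_)
    rcases eq_or_ne j i with rfl | hj
    · simp
    · simp [hj]
  rw [this, integral_map hu.aemeasurable hm.aestronglyMeasurable,
    integral_prod (fun p : B i × (∀ j, B j) => h (Function.update p.2 i p.1))
      (integrable_of_abs_le _ (hm.comp hu) fun p => hM _)]

/-- Relabelling the actions of a single player. -/
lemma expect_update_map (hf : IsAdmissible f) (i : P) {s : B i → B i} (hs : Measurable s) :
    expect q (Function.update τ i fun t => (τ i t).map hs.aemeasurable) f =
      expect q τ fun θ a => f θ (Function.update a i (s (a i))) := by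
  obtain ⟨hm, M, hM⟩ := hf
  have key : ∀ θ, ∫ a, f θ a ∂(actionLaw
      (Function.update τ i fun t => (τ i t).map hs.aemeasurable) θ) =
      ∫ a, f θ (Function.update a i (s (a i))) ∂(actionLaw τ θ) := fun θ => by
    have h1 := integral_actionLaw_update (τ := τ) i (fun t => (τ i t).map hs.aemeasurable) θ
      (hm θ) (hM θ)
    have hm2 : Measurable fun a : ∀ j, B j => f θ (Function.update a i (s (a i))) :=
      (hm θ).comp (measurable_update'.comp
        (measurable_id.prodMk (hs.comp (measurable_pi_apply i))))
    have h2 := integral_actionLaw_update (τ := τ) i (τ i) θ hm2 (fun a => hM θ _)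
    rw [Function.update_eq_self] at h2
    rw [h1, h2]
    have h3 : Measurable fun x => ∫ b, f θ (Function.update b i x) ∂(actionLaw τ θ) :=
      (StronglyMeasurable.integral_prod_right (ν := actionLaw τ θ)
        (f := fun (x : B i) b => f θ (Function.update b i x))
        ((hm θ).comp (measurable_update'.comp measurable_swap)).stronglyMeasurable).measurable
    rw [ProbabilityMeasure.toMeasure_map, integral_map hs.aemeasurable h3.aestronglyMeasurable]
    simp
  exact tsum_congr fun θ => by rw [key]

end Expectation

section Conditional

variable {P : Type v} [Fintype P] {T : P → Type w} {A : P → Type u} [∀ i, MeasurableSpace (A i)]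

/-! ### The utility a player expects from an action, given its type -/

/-- The prior conditioned on player `i` having type `t`. -/
noncomputable def condPrior (Γ : BayesianGame P T A) (i : P) (t : T i) : PMF (∀ j, T j) :=
  Γ.prior.filter {θ | θ i = t} <| by
    obtain ⟨θ, h, hpos⟩ := Γ.prior_pos i t
    exact ⟨θ, h, (PMF.mem_support_iff _ _).2 hpos.ne'⟩

lemma countable_typeProfiles (Γ : BayesianGame P T A) : Countable (∀ j, T j) := by
  have : ∀ j, Countable (T j) := fun j => by
    have hc := Γ.prior.support_countable.image fun θ => θ j
    refine Set.countable_univ_iff.1 (hc.mono fun t _ => ?_)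
    obtain ⟨θ, h, hpos⟩ := Γ.prior_pos j t
    exact ⟨θ, (PMF.mem_support_iff _ _).2 hpos.ne', h⟩
  infer_instance

lemma condPrior_eq_zero (Γ : BayesianGame P T A) {i : P} {t : T i} {θ : ∀ j, T j}
    (h : θ i ≠ t) : Γ.condPrior i t θ = 0 :=
  PMF.filter_apply_eq_zero_of_notMem _ h

/-- Resampling the type profile given the type of player `i` leaves the prior unchanged. -/
lemma tsum_prior_mul_condPrior (Γ : BayesianGame P T A) (i : P) (θ' : ∀ j, T j) :
    ∑' θ, Γ.prior θ * Γ.condPrior i (θ i) θ' = Γ.prior θ' := by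
  set Z := ∑' θ, Set.indicator {θ | θ i = θ' i} Γ.prior θ with hZ
  have hZ0 : Z ≠ 0 := by
    obtain ⟨θ, h, hpos⟩ := Γ.prior_pos i (θ' i)
    refine fun h0 => hpos.ne' ?_
    have := ENNReal.tsum_eq_zero.1 h0 θ
    rwa [Set.indicator_of_mem (show θ ∈ {θ | θ i = θ' i} from h)] at this
  have hZt : Z ≠ ⊤ := Γ.prior.tsum_coe_indicator_ne_top _
  have : ∀ θ, Γ.prior θ * Γ.condPrior i (θ i) θ' =
      Set.indicator {θ | θ i = θ' i} Γ.prior θ * (Γ.prior θ' * Z⁻¹) := by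
    intro θ
    by_cases h : θ i = θ' i
    · rw [Set.indicator_of_mem (show θ ∈ {θ | θ i = θ' i} from h), condPrior, PMF.filter_apply,
        Set.indicator_of_mem (show θ' ∈ {θ'' | θ'' i = θ i} from h.symm), h, hZ]
    · rw [Set.indicator_of_notMem (show θ ∉ {θ | θ i = θ' i} from h),
        Γ.condPrior_eq_zero (Ne.symm h)]
      simp
  rw [tsum_congr this, ENNReal.tsum_mul_right, ← hZ, mul_comm, mul_assoc,
    ENNReal.inv_mul_cancel hZ0 hZt, mul_one]

/-- The tower property: a quantity that depends on the type of `i` and on the type profile may be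
replaced by its conditional expectation given the type of `i`. -/
lemma tsum_prior_mul_tsum_condPrior (Γ : BayesianGame P T A) (i : P) {H : T i → (∀ j, T j) → ℝ}
    {M : ℝ} (hM : ∀ t θ, |H t θ| ≤ M) :
    ∑' θ, (Γ.prior θ).toReal * ∑' θ', (Γ.condPrior i (θ i) θ').toReal * H (θ i) θ' =
      ∑' θ, (Γ.prior θ).toReal * H (θ i) θ := by
  have hsum : Summable fun p : (∀ j, T j) × (∀ j, T j) =>
      (Γ.prior p.1 * Γ.condPrior i (p.1 i) p.2).toReal := by
    refine ENNReal.summable_toReal ?_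
    rw [ENNReal.tsum_prod (f := fun θ θ' => Γ.prior θ * Γ.condPrior i (θ i) θ')]
    simp_rw [ENNReal.tsum_mul_left, PMF.tsum_coe, mul_one]
    exact Γ.prior.tsum_coe_ne_top
  have hsum' : Summable fun p : (∀ j, T j) × (∀ j, T j) =>
      (Γ.prior p.1 * Γ.condPrior i (p.1 i) p.2).toReal * H (p.2 i) p.2 := by
    refine Summable.of_norm_bounded (hsum.mul_right M) fun p => ?_
    rw [norm_mul, Real.norm_of_nonneg ENNReal.toReal_nonneg]
    exact mul_le_mul_of_nonneg_left (hM _ _) ENNReal.toReal_nonneg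
  calc ∑' θ, (Γ.prior θ).toReal * ∑' θ', (Γ.condPrior i (θ i) θ').toReal * H (θ i) θ'
      = ∑' θ, ∑' θ', (Γ.prior θ * Γ.condPrior i (θ i) θ').toReal * H (θ' i) θ' := by
        refine tsum_congr fun θ => ?_
        rw [← tsum_mul_left]
        refine tsum_congr fun θ' => ?_
        -- The two arguments of `H` only differ where the conditional prior vanishes.
        by_cases h : θ' i = θ i
        · rw [ENNReal.toReal_mul, h, mul_assoc]
        · simp [Γ.condPrior_eq_zero h]
    _ = ∑' θ', ∑' θ, (Γ.prior θ * Γ.condPrior i (θ i) θ').toReal * H (θ' i) θ' :=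
        (Summable.tsum_comm hsum').symm
    _ = ∑' θ, (Γ.prior θ).toReal * H (θ i) θ := by
        refine tsum_congr fun θ' => ?_
        rw [tsum_mul_right, ← ENNReal.tsum_toReal_eq, tsum_prior_mul_condPrior]
        exact fun θ => ENNReal.mul_ne_top (PMF.apply_ne_top _ _) (PMF.apply_ne_top _ _)

variable [DecidableEq P]

/-- The expected utility of player `i` when it has type `t` and plays `x`, while the other players
follow `σ`. -/
noncomputable def condUtility (Γ : BayesianGame P T A) (σ : Γ.Profile) (i : P) (t : T i)
    (x : A i) : ℝ :=
  expect (Γ.condPrior i t) σ fun _ b => Γ.utility i t (Function.update b i x)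

lemma measurable_integral_update (Γ : BayesianGame P T A) (σ : Γ.Profile) (i : P) (t : T i)
    (θ : ∀ j, T j) :
    Measurable fun x => ∫ b, Γ.utility i t (Function.update b i x) ∂(actionLaw σ θ) :=
  (StronglyMeasurable.integral_prod_right (ν := actionLaw σ θ)
    (f := fun (x : A i) b => Γ.utility i t (Function.update b i x))
    ((Γ.measurable_utility i t).comp
      (measurable_update'.comp measurable_swap)).stronglyMeasurable).measurable

lemma measurable_condUtility (Γ : BayesianGame P T A) (σ : Γ.Profile) (i : P) (t : T i) :
    Measurable (Γ.condUtility σ i t) := by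
  have := Γ.countable_typeProfiles
  exact Measurable.tsum fun θ => (Γ.measurable_integral_update σ i t θ).const_mul _

lemma abs_condUtility_le (Γ : BayesianGame P T A) (σ : Γ.Profile) {M : ℝ}
    (hM : ∀ i t a, |Γ.utility i t a| ≤ M) (i : P) (t : T i) (x : A i) :
    |Γ.condUtility σ i t x| ≤ M := by
  have hb : ∀ θ, |∫ b, Γ.utility i t (Function.update b i x) ∂(actionLaw σ θ)| ≤ M :=
    fun θ => abs_integral_le_of_abs_le _ fun b => hM i t _
  have hs := summable_prior_mul (Γ.condPrior i t) hb
  have h1 : ∑' θ, (Γ.condPrior i t θ).toReal * M = M := by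
    rw [tsum_mul_right, ← ENNReal.tsum_toReal_eq fun θ => PMF.apply_ne_top _ _, PMF.tsum_coe]
    simp
  have hs1 : Summable fun θ => (Γ.condPrior i t θ).toReal * M :=
    (ENNReal.summable_toReal (Γ.condPrior i t).tsum_coe_ne_top).mul_right M
  refine abs_le.2 ⟨?_, ?_⟩
  · rw [← h1, ← tsum_neg]
    refine hs1.neg.tsum_le_tsum (fun θ => ?_) hs
    rw [← mul_neg]
    exact mul_le_mul_of_nonneg_left (abs_le.1 (hb θ)).1 ENNReal.toReal_nonneg
  · conv_rhs => rw [← h1]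
    exact hs.tsum_le_tsum (fun θ => mul_le_mul_of_nonneg_left (abs_le.1 (hb θ)).2
      ENNReal.toReal_nonneg) hs1

/-- Averaging the conditional expected utility over random actions. -/
lemma integral_mul_condUtility (Γ : BayesianGame P T A) (σ : Γ.Profile) {M : ℝ}
    (hM : ∀ i t a, |Γ.utility i t a| ≤ M) (i : P) (t : T i) {X : Type*} [MeasurableSpace X]
    (ν : Measure X) [IsProbabilityMeasure ν] {p : X → A i} (hp : Measurable p) {φ : X → ℝ}
    (hφ : Measurable φ) {C : ℝ} (hC : ∀ x, |φ x| ≤ C) :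
    ∫ x, φ x * Γ.condUtility σ i t (p x) ∂ν =
      ∑' θ, (Γ.condPrior i t θ).toReal *
        ∫ x, φ x * ∫ b, Γ.utility i t (Function.update b i (p x)) ∂(actionLaw σ θ) ∂ν := by
  have := Γ.countable_typeProfiles
  let F : (∀ j, T j) → X → ℝ := fun θ x => (Γ.condPrior i t θ).toReal *
    (φ x * ∫ b, Γ.utility i t (Function.update b i (p x)) ∂(actionLaw σ θ))
  have hbd : ∀ θ x, |φ x * ∫ b, Γ.utility i t (Function.update b i (p x)) ∂(actionLaw σ θ)| ≤
      C * M := fun θ x => by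
    rw [abs_mul]
    exact mul_le_mul (hC x) (abs_integral_le_of_abs_le _ fun b => hM i t _) (abs_nonneg _)
      ((abs_nonneg _).trans (hC x))
  have hF : ∀ θ x, ‖F θ x‖ ≤ (Γ.condPrior i t θ).toReal * (C * M) := fun θ x => by
    rw [norm_mul, Real.norm_of_nonneg ENNReal.toReal_nonneg]
    exact mul_le_mul_of_nonneg_left (hbd θ x) ENNReal.toReal_nonneg
  have hFm : ∀ θ, Measurable (F θ) := fun θ =>
    (hφ.mul ((Γ.measurable_integral_update σ i t θ).comp hp)).const_mul _
  have hFi : ∀ θ, Integrable (F θ) ν := fun θ => integrable_of_abs_le ν (hFm θ) (hF θ)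
  have hs : Summable fun θ => ∫ x, ‖F θ x‖ ∂ν := by
    refine Summable.of_nonneg_of_le (fun θ => integral_nonneg fun x => norm_nonneg _)
      (fun θ => ?_)
      ((ENNReal.summable_toReal (Γ.condPrior i t).tsum_coe_ne_top).mul_right (C * M))
    simpa using integral_mono (hFi θ).norm (integrable_const _) (hF θ)
  have h := integral_tsum_of_summable_integral_norm hFi hs
  simp only [F, integral_const_mul] at h
  rw [h]
  refine integral_congr_ae (Filter.Eventually.of_forall fun x => ?_)
  simp only [condUtility, expect]
  rw [← tsum_mul_left]
  exact tsum_congr fun θ => by ring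

end Conditional

section ExtendedGame

/-! ### The extended game -/

variable {P : Type v} {T : P → Type w} {A : P → Type u} {W : Type u}

/-- The original action that is carried out by an action of player `i` in the extended game: an
action in `A i` carries out itself, and a new action, which is a code `w` for an action profile
`e w`, carries out the component of `i` of that profile. -/
def proj (e : W → ∀ j, A j) (i : P) : A i ⊕ W → A i :=
  Sum.elim id fun w => e w i

/-- The indicator function of the new actions. -/
def isNew {α : Type*} : α ⊕ W → ℝ :=
  Sum.elim (fun _ => 0) fun _ => 1

open Classical in
/-- The indicator function of the event that some opponent of `i` plays a new action. -/
noncomputable def othersNew (i : P) (a : ∀ j, A j ⊕ W) : ℝ :=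
  if ∀ j, j ≠ i → (a j).isLeft = true then 0 else 1

lemma isNew_nonneg {α : Type*} (x : α ⊕ W) : 0 ≤ isNew x := by
  rcases x with x | x <;> simp [isNew]

lemma isNew_le_one {α : Type*} (x : α ⊕ W) : isNew x ≤ 1 := by
  rcases x with x | x <;> simp [isNew]

lemma abs_isNew_le {α : Type*} (x : α ⊕ W) : |isNew x| ≤ 1 := by
  rw [abs_of_nonneg (isNew_nonneg x)]
  exact isNew_le_one x

lemma othersNew_eq_zero_or_one (i : P) (a : ∀ j, A j ⊕ W) :
    othersNew i a = 0 ∨ othersNew i a = 1 := by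
  unfold othersNew
  split_ifs <;> simp

lemma abs_othersNew_le (i : P) (a : ∀ j, A j ⊕ W) : |othersNew i a| ≤ 1 := by
  rcases othersNew_eq_zero_or_one i a with h | h <;> simp [h]

lemma isNew_le_othersNew {i k : P} (h : i ≠ k) (a : ∀ j, A j ⊕ W) :
    isNew (a i) ≤ othersNew k a := by
  unfold othersNew
  split_ifs with hk
  · have := hk i h
    rcases hx : a i with x | x
    · simp [isNew]
    · simp [hx] at this
  · exact isNew_le_one _

section Update

variable [DecidableEq P]

lemma othersNew_update (i : P) (a : ∀ j, A j ⊕ W) (x : A i ⊕ W) :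
    othersNew i (Function.update a i x) = othersNew i a := by
  unfold othersNew
  congr 1
  refine propext (forall₂_congr fun j hj => ?_)
  rw [Function.update_of_ne hj]

lemma othersNew_update_inl (i : P) (b : ∀ j, A j) (x : A i ⊕ W) :
    othersNew i (Function.update (fun j => Sum.inl (b j)) i x) = 0 := by
  rw [othersNew_update]
  simp [othersNew]

lemma proj_update (e : W → ∀ j, A j) (i : P) (a : ∀ j, A j ⊕ W) (x : A i ⊕ W) :
    (fun j => proj e j (Function.update a i x j)) =
      Function.update (fun j => proj e j (a j)) i (proj e i x) := by
  funext j
  rcases eq_or_ne j i with rfl | hj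
  · simp
  · simp [hj]

end Update

variable [∀ i, MeasurableSpace (A i)] [MeasurableSpace W]

lemma measurable_proj {e : W → ∀ j, A j} (he : Measurable e) (i : P) :
    Measurable (proj e i) :=
  measurable_id.sumElim ((measurable_pi_apply i).comp he)

lemma measurable_isNew {α : Type*} [MeasurableSpace α] :
    Measurable (isNew : α ⊕ W → ℝ) :=
  measurable_const.sumElim measurable_const

variable [Fintype P]

lemma measurable_othersNew (i : P) :
    Measurable (othersNew i : (∀ j, A j ⊕ W) → ℝ) := by
  classical
  refine Measurable.ite ?_ measurable_const measurable_const
  have hl : ∀ j, Measurable fun x : A j ⊕ W => x.isLeft := fun j =>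
    measurable_fun_sum (measurable_const (a := true)) (measurable_const (a := false))
  have : {a : ∀ j, A j ⊕ W | ∀ j, j ≠ i → (a j).isLeft = true} =
      ⋂ j, ⋂ _ : j ≠ i, (fun a => (a j).isLeft) ⁻¹' {true} := by
    ext a
    simp
  rw [this]
  exact .iInter fun j => .iInter fun _ =>
    ((hl j).comp (measurable_pi_apply j)) (measurableSet_singleton true)

variable [DecidableEq P]

/-- The utility of player `i` in the extended game. As long as all opponents play original actions,
a new action of `i` adds to the utility the amount by which the outcome exceeds what `i` expects
under `σ`. As soon as an opponent plays a new action, `i` is fined. -/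
noncomputable def extUtility (Γ : BayesianGame P T A) (σ : Γ.Profile) (e : W → ∀ j, A j) (M : ℝ)
    (i : P) (t : T i) (a : ∀ j, A j ⊕ W) : ℝ :=
  (1 - othersNew i a) * ((1 + isNew (a i)) * Γ.utility i t (fun j => proj e j (a j)) -
    isNew (a i) * Γ.condUtility σ i t (proj e i (a i))) - 5 * M * othersNew i a

omit [DecidableEq P] in
lemma measurable_utility_proj (Γ : BayesianGame P T A) {e : W → ∀ j, A j} (he : Measurable e)
    (i : P) (t : T i) :
    Measurable fun a : ∀ j, A j ⊕ W => Γ.utility i t fun j => proj e j (a j) :=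
  (Γ.measurable_utility i t).comp (measurable_pi_lambda _ fun j =>
    (measurable_proj he j).comp (measurable_pi_apply j))

lemma measurable_extUtility (Γ : BayesianGame P T A) (σ : Γ.Profile) {e : W → ∀ j, A j}
    (he : Measurable e) (M : ℝ) (i : P) (t : T i) : Measurable (Γ.extUtility σ e M i t) := by
  have h1 := Γ.measurable_utility_proj he i t
  have h2 : Measurable fun a : ∀ j, A j ⊕ W => Γ.condUtility σ i t (proj e i (a i)) :=
    (Γ.measurable_condUtility σ i t).comp ((measurable_proj he i).comp (measurable_pi_apply i))
  have h3 : Measurable fun a : ∀ j, A j ⊕ W => isNew (a i) :=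
    measurable_isNew.comp (measurable_pi_apply i)
  have h4 := measurable_othersNew (A := A) (W := W) i
  exact ((measurable_const.sub h4).mul (((measurable_const.add h3).mul h1).sub
    (h3.mul h2))).sub (measurable_const.mul h4)

omit [MeasurableSpace W] in
lemma abs_extUtility_le (Γ : BayesianGame P T A) (σ : Γ.Profile) (e : W → ∀ j, A j) {M : ℝ}
    (hM : ∀ i t a, |Γ.utility i t a| ≤ M) (i : P) (t : T i) (a : ∀ j, A j ⊕ W) :
    |Γ.extUtility σ e M i t a| ≤ 5 * M := by
  have h1 := abs_le.1 (hM i t fun j => proj e j (a j))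
  have h2 := abs_le.1 (Γ.abs_condUtility_le σ hM i t (proj e i (a i)))
  unfold extUtility
  rcases othersNew_eq_zero_or_one i a with h | h
  · have h3 : isNew (a i) = 0 ∨ isNew (a i) = 1 := by
      rcases a i with x | x <;> simp [isNew]
    rcases h3 with h3 | h3 <;> rw [h, h3, abs_le] <;> constructor <;> linarith
  · rw [h, abs_le]
    constructor <;> linarith

/-- The extended game: every player may, in addition to its original actions, play an element
of `W`, which codes an action profile of `Γ` via `e`. -/
noncomputable def extGame (Γ : BayesianGame P T A) (σ : Γ.Profile) {e : W → ∀ j, A j}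
    (he : Measurable e) (M : ℝ) : BayesianGame P T fun i => A i ⊕ W where
  prior := Γ.prior
  prior_pos := Γ.prior_pos
  utility := Γ.extUtility σ e M
  measurable_utility := Γ.measurable_extUtility σ he M

omit [MeasurableSpace W] in
lemma extUtility_inl (Γ : BayesianGame P T A) (σ : Γ.Profile) (e : W → ∀ j, A j) (M : ℝ)
    (i : P) (t : T i) (a : ∀ j, A j) :
    Γ.extUtility σ e M i t (fun j => Sum.inl (a j)) = Γ.utility i t a := by
  simp [extUtility, othersNew, isNew, proj]

omit [MeasurableSpace W] in
/-- If all opponents play original actions, only the fine disappears. -/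
lemma extUtility_update_inl (Γ : BayesianGame P T A) (σ : Γ.Profile) (e : W → ∀ j, A j) (M : ℝ)
    (i : P) (t : T i) (b : ∀ j, A j) (x : A i ⊕ W) :
    Γ.extUtility σ e M i t (Function.update (fun j => Sum.inl (b j)) i x) =
      (1 + isNew x) * Γ.utility i t (Function.update b i (proj e i x)) -
        isNew x * Γ.condUtility σ i t (proj e i x) := by
  unfold extUtility
  rw [othersNew_update_inl, proj_update]
  simp only [Function.update_self, sub_zero, one_mul, mul_zero]
  rfl

/-- The new counterpart of an action of player `i`: a new action that carries out the same original
action. The components of the other players in the reported profile are irrelevant, and are taken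
from `d`. -/
def toNew (e : W ≃ᵐ ∀ j, A j) (d : ∀ j, A j) (i : P) : A i ⊕ W → A i ⊕ W :=
  Sum.elim (fun x => Sum.inr (e.symm (Function.update d i x))) Sum.inr

omit [Fintype P] in
lemma measurable_toNew (e : W ≃ᵐ ∀ j, A j) (d : ∀ j, A j) (i : P) : Measurable (toNew e d i) :=
  (measurable_inr.comp (e.symm.measurable.comp (measurable_update d))).sumElim measurable_inr

omit [Fintype P] in
lemma proj_toNew (e : W ≃ᵐ ∀ j, A j) (d : ∀ j, A j) (i : P) (x : A i ⊕ W) :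
    proj e i (toNew e d i x) = proj e i x := by
  rcases x with x | x <;> simp [proj, toNew]

omit [Fintype P] in
lemma isNew_toNew (e : W ≃ᵐ ∀ j, A j) (d : ∀ j, A j) (i : P) (x : A i ⊕ W) :
    isNew (toNew e d i x) = 1 := by
  rcases x with x | x <;> simp [isNew, toNew]

/-- The pointwise inequality behind the theorem. The second summand on the right is what `i` gains
by switching to the new counterpart of its action, which is not positive on average if `i` plays a best
response. The factor `4 * M` bounds twice the surplus `u - c`, which remains if `i` plays a new
action, and the payoff `-5 * M` after a new action of an opponent is at most `c - 4 * M`. -/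
lemma extUtility_le (Γ : BayesianGame P T A) (σ : Γ.Profile) (e : W ≃ᵐ ∀ j, A j)
    (d : ∀ j, A j) {M : ℝ} (hM : ∀ i t a, |Γ.utility i t a| ≤ M) (i : P) (t : T i)
    (a : ∀ j, A j ⊕ W) :
    Γ.extUtility σ e M i t a ≤ Γ.condUtility σ i t (proj e i (a i)) +
      (Γ.extUtility σ e M i t (Function.update a i (toNew e d i (a i))) -
        Γ.extUtility σ e M i t a) + 4 * M * (isNew (a i) - othersNew i a) := by
  have h1 := abs_le.1 (hM i t fun j => proj e j (a j))
  have h2 := abs_le.1 (Γ.abs_condUtility_le σ hM i t (proj e i (a i)))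
  have hp : (fun j => proj e j (Function.update a i (toNew e d i (a i)) j)) =
      fun j => proj e j (a j) := by
    rw [proj_update, proj_toNew]
    exact Function.update_eq_self i _
  have h3 : isNew (a i) = 0 ∨ isNew (a i) = 1 := by
    rcases a i with x | x <;> simp [isNew]
  unfold extUtility
  rw [othersNew_update, hp, Function.update_self, isNew_toNew, proj_toNew]
  rcases othersNew_eq_zero_or_one i a with h | h <;> rcases h3 with h3 | h3 <;> rw [h, h3] <;>
    linarith

end ExtendedGame

section Expected

/-! ### Expected utilities in the extended game -/

variable {P : Type v} [Fintype P] [DecidableEq P] {T : P → Type w} {A : P → Type u}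
  [∀ i, MeasurableSpace (A i)] {W : Type u} [MeasurableSpace W]

/-- A strategy profile of a game, viewed as a profile of the extended game. -/
noncomputable def liftInl (W : Type u) [MeasurableSpace W]
    (σ : ∀ j, T j → ProbabilityMeasure (A j)) : ∀ j, T j → ProbabilityMeasure (A j ⊕ W) :=
  fun j t => (σ j t).map measurable_inl.aemeasurable

/-- The strategy of the original game that carries out the actions of a strategy of the extended
game. -/
noncomputable def projStrategy {e : W → ∀ j, A j} (he : Measurable e) (i : P)
    (ν : T i → ProbabilityMeasure (A i ⊕ W)) : T i → ProbabilityMeasure (A i) :=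
  fun t => (ν t).map (measurable_proj he i).aemeasurable

omit [Fintype P] [DecidableEq P] in
lemma projStrategy_liftInl (σ : ∀ j, T j → ProbabilityMeasure (A j)) {e : W → ∀ j, A j}
    (he : Measurable e) (i : P) : projStrategy he i (liftInl W σ i) = σ i := by
  funext t
  refine Subtype.ext ?_
  change ((σ i t : Measure (A i)).map Sum.inl).map (proj e i) = (σ i t : Measure (A i))
  rw [Measure.map_map (measurable_proj he i) measurable_inl]
  exact Measure.map_id

variable {q : PMF (∀ j, T j)}

/-- The integral over a profile in which all players but `i` follow a lifted profile. -/
lemma integral_update_liftInl (σ : ∀ j, T j → ProbabilityMeasure (A j)) (i : P)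
    (ν : T i → ProbabilityMeasure (A i ⊕ W)) {f : (∀ j, T j) → (∀ j, A j ⊕ W) → ℝ}
    (hf : IsAdmissible f) (θ : ∀ j, T j) :
    ∫ a, f θ a ∂(actionLaw (Function.update (liftInl W σ) i ν) θ) =
      ∫ x, ∫ b, f θ (Function.update (fun j => Sum.inl (b j)) i x) ∂(actionLaw σ θ)
        ∂(ν (θ i) : Measure (A i ⊕ W)) := by
  rw [integral_actionLaw_update i ν θ (hf.1 θ) (hf.2.choose_spec θ)]
  refine integral_congr_ae (Filter.Eventually.of_forall fun x => ?_)
  exact integral_actionLaw_map (τ := σ) (fun _ => measurable_inl) θ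
    ((hf.1 θ).comp measurable_update_left)

/-- Against a lifted profile, only the values matter that `f` takes when all opponents play original
actions. -/
lemma expect_update_liftInl_congr (σ : ∀ j, T j → ProbabilityMeasure (A j)) (i : P)
    (ν : T i → ProbabilityMeasure (A i ⊕ W)) {f g : (∀ j, T j) → (∀ j, A j ⊕ W) → ℝ}
    (hf : IsAdmissible f) (hg : IsAdmissible g)
    (h : ∀ θ (b : ∀ j, A j) x, f θ (Function.update (fun j => Sum.inl (b j)) i x) =
      g θ (Function.update (fun j => Sum.inl (b j)) i x)) :
    expect q (Function.update (liftInl W σ) i ν) f =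
      expect q (Function.update (liftInl W σ) i ν) g :=
  tsum_congr fun θ => by
    rw [integral_update_liftInl σ i ν hf, integral_update_liftInl σ i ν hg]
    simp only [h]

omit [DecidableEq P] in
/-- The expectation of a function of the type and the action of `i` only depends on the strategy
of `i`. -/
lemma expect_eq_of_depends_on_own {B : P → Type u} [∀ i, MeasurableSpace (B i)] (i : P)
    {g : T i → B i → ℝ} (hg : ∀ t, Measurable (g t))
    (τ τ' : ∀ j, T j → ProbabilityMeasure (B j)) (h : τ i = τ' i) :
    expect q τ (fun θ a => g (θ i) (a i)) = expect q τ' fun θ a => g (θ i) (a i) := by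
  have key : ∀ (τ : ∀ j, T j → ProbabilityMeasure (B j)) (θ : ∀ j, T j),
      ∫ a, g (θ i) (a i) ∂(actionLaw τ θ) = ∫ x, g (θ i) x ∂(τ i (θ i) : Measure (B i)) :=
    fun τ θ => by
      have := measurePreserving_eval (fun j => (τ j (θ j) : Measure (B j))) i
      rw [← this.map_eq, integral_map this.measurable.aemeasurable (hg _).aestronglyMeasurable]
  exact tsum_congr fun θ => by rw [key, key, h]

variable (Γ : BayesianGame P T A) (σ : Γ.Profile) {M : ℝ} (hM : ∀ i t a, |Γ.utility i t a| ≤ M)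
  {e : W → ∀ j, A j} (he : Measurable e)

include hM he

omit [DecidableEq P] in
lemma isAdmissible_utility_proj (i : P) : IsAdmissible fun (θ : ∀ j, T j) (a : ∀ j, A j ⊕ W) =>
    Γ.utility i (θ i) fun j => proj e j (a j) :=
  ⟨fun θ => Γ.measurable_utility_proj he i (θ i), M, fun _ _ => hM i _ _⟩

lemma isAdmissible_condUtility_proj (i : P) :
    IsAdmissible fun (θ : ∀ j, T j) (a : ∀ j, A j ⊕ W) =>
      Γ.condUtility σ i (θ i) (proj e i (a i)) :=
  ⟨fun θ => (Γ.measurable_condUtility σ i (θ i)).comp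
    ((measurable_proj he i).comp (measurable_pi_apply i)), M,
    fun θ _ => Γ.abs_condUtility_le σ hM i (θ i) _⟩

lemma isAdmissible_extUtility (i : P) : IsAdmissible fun (θ : ∀ j, T j) (a : ∀ j, A j ⊕ W) =>
    Γ.extUtility σ e M i (θ i) a :=
  ⟨fun θ => Γ.measurable_extUtility σ he M i (θ i), 5 * M,
    fun θ a => Γ.abs_extUtility_le σ e hM i (θ i) a⟩

omit [Fintype P] [DecidableEq P] hM he in
lemma isAdmissible_mul_own {f : (∀ j, T j) → (∀ j, A j ⊕ W) → ℝ} (hf : IsAdmissible f) (i : P)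
    {φ : A i ⊕ W → ℝ} (hφ : Measurable φ) {C : ℝ} (hC : ∀ x, |φ x| ≤ C) :
    IsAdmissible fun θ a => φ (a i) * f θ a := by
  obtain ⟨hf, N, hN⟩ := hf
  refine ⟨fun θ => (hφ.comp (measurable_pi_apply i)).mul (hf θ), C * N, fun θ a => ?_⟩
  rw [abs_mul]
  exact mul_le_mul (hC _) (hN θ a) (abs_nonneg _) ((abs_nonneg _).trans (hC (a i)))

/-- Against `σ`, the utility of player `i` may be replaced by its conditional expected utility, also
when it is weighted by a function of the action of `i`. In particular the surplus that a new action
pays vanishes on average. -/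
lemma expect_mul_utility_eq_expect_mul_condUtility (i : P)
    (ν : T i → ProbabilityMeasure (A i ⊕ W)) {φ : A i ⊕ W → ℝ} (hφ : Measurable φ) {C : ℝ}
    (hC : ∀ x, |φ x| ≤ C) :
    expect Γ.prior (Function.update (liftInl W σ) i ν)
        (fun θ a => φ (a i) * Γ.utility i (θ i) fun j => proj e j (a j)) =
      expect Γ.prior (Function.update (liftInl W σ) i ν)
        fun θ a => φ (a i) * Γ.condUtility σ i (θ i) (proj e i (a i)) := by
  have hu := isAdmissible_mul_own (isAdmissible_utility_proj Γ hM he i) i hφ hC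
  have hc := isAdmissible_mul_own (isAdmissible_condUtility_proj Γ σ hM he i) i hφ hC
  let H : T i → (∀ j, T j) → ℝ := fun t θ => ∫ x, φ x *
    ∫ b, Γ.utility i t (Function.update b i (proj e i x)) ∂(actionLaw σ θ)
      ∂(ν t : Measure (A i ⊕ W))
  have hH : ∀ t θ, |H t θ| ≤ C * M := fun t θ => by
    refine abs_integral_le_of_abs_le _ fun x => ?_
    rw [abs_mul]
    exact mul_le_mul (hC x) (abs_integral_le_of_abs_le _ fun b => hM i t _) (abs_nonneg _)
      ((abs_nonneg _).trans (hC x))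
  have h1 : ∀ θ : ∀ j, T j, ∫ a, φ (a i) * Γ.utility i (θ i) (fun j => proj e j (a j))
      ∂(actionLaw (Function.update (liftInl W σ) i ν) θ) = H (θ i) θ := fun θ => by
    rw [integral_update_liftInl σ i ν hu]
    simp only [Function.update_self, proj_update, integral_const_mul]
    rfl
  have h2 : ∀ θ : ∀ j, T j, ∫ a, φ (a i) * Γ.condUtility σ i (θ i) (proj e i (a i))
      ∂(actionLaw (Function.update (liftInl W σ) i ν) θ) =
        ∑' θ', (Γ.condPrior i (θ i) θ').toReal * H (θ i) θ' := fun θ => by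
    rw [integral_update_liftInl σ i ν hc]
    simp only [Function.update_self, integral_const, probReal_univ, one_smul]
    exact Γ.integral_mul_condUtility σ hM i (θ i) _ (measurable_proj he i) hφ hC
  simp only [expect, h1, h2]
  exact (Γ.tsum_prior_mul_tsum_condPrior i hH).symm

/-- The expectation of the conditional expected utility is what `i` would get against `σ`. -/
lemma expect_condUtility (i : P) (ρ : ∀ j, T j → ProbabilityMeasure (A j ⊕ W)) :
    expect Γ.prior ρ (fun θ a => Γ.condUtility σ i (θ i) (proj e i (a i))) =
      Γ.expectedUtility (Function.update σ i (projStrategy he i (ρ i))) i := by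
  have h1 := expect_eq_of_depends_on_own (q := Γ.prior) i
    (fun t => (Γ.measurable_condUtility σ i t).comp (measurable_proj he i)) ρ
    (Function.update (liftInl W σ) i (ρ i)) (by simp)
  have h2 := expect_mul_utility_eq_expect_mul_condUtility Γ σ hM he i (ρ i)
    (φ := fun _ => 1) measurable_const (C := 1) (by simp)
  simp only [one_mul] at h2
  refine h1.trans (h2.symm.trans ?_)
  rw [← expect_map (measurable_proj he) (h := fun θ a => Γ.utility i (θ i) a)
    (fun θ => Γ.measurable_utility i (θ i))]
  have h3 : (fun j t => (Function.update (liftInl W σ) i (ρ i) j t).map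
      (measurable_proj he j).aemeasurable) =
      Function.update σ i (projStrategy he i (ρ i)) := by
    funext j
    rcases eq_or_ne j i with rfl | hj
    · simp only [Function.update_self]
      rfl
    · simp only [ne_eq, hj, not_false_eq_true, Function.update_of_ne]
      exact projStrategy_liftInl σ he j
  rw [h3]
  rfl

omit hM in
lemma expectedUtility_liftInl (i : P) :
    (Γ.extGame σ he M).expectedUtility (liftInl W σ) i = Γ.expectedUtility σ i := by
  refine (expect_map (q := Γ.prior) (τ := σ) (fun j => measurable_inl)
    (fun θ => Γ.measurable_extUtility σ he M i (θ i))).trans ?_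
  simp only [extUtility_inl]
  rfl

/-- Against `σ`, no strategy of the extended game is better than the original strategy with the same
underlying actions. -/
lemma expectedUtility_update_liftInl (i : P) (ν : T i → ProbabilityMeasure (A i ⊕ W)) :
    (Γ.extGame σ he M).expectedUtility (Function.update (liftInl W σ) i ν) i =
      Γ.expectedUtility (Function.update σ i (projStrategy he i ν)) i := by
  have hφ : Measurable fun x : A i ⊕ W => 1 + isNew x := measurable_const.add measurable_isNew
  have hC : ∀ x : A i ⊕ W, |1 + isNew x| ≤ 2 := fun x => by
    have h0 := isNew_nonneg x
    have h1 := isNew_le_one x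
    rw [abs_le]
    constructor <;> linarith
  have hu := isAdmissible_mul_own (isAdmissible_utility_proj Γ hM he i) i hφ hC
  have hc := isAdmissible_condUtility_proj Γ σ hM he i
  have hc1 := isAdmissible_mul_own hc i hφ hC
  have hc2 := isAdmissible_mul_own hc i measurable_isNew abs_isNew_le
  have h1 : (Γ.extGame σ he M).expectedUtility (Function.update (liftInl W σ) i ν) i =
      expect Γ.prior (Function.update (liftInl W σ) i ν) fun θ a =>
        (1 + isNew (a i)) * Γ.utility i (θ i) (fun j => proj e j (a j)) -
          isNew (a i) * Γ.condUtility σ i (θ i) (proj e i (a i)) := by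
    refine expect_update_liftInl_congr σ i ν (isAdmissible_extUtility Γ σ hM he i)
      (hu.sub hc2) fun θ b x => ?_
    rw [proj_update, Function.update_self]
    exact Γ.extUtility_update_inl σ e M i (θ i) b x
  rw [h1, expect_sub hu hc2, expect_mul_utility_eq_expect_mul_condUtility Γ σ hM he i ν hφ hC,
    ← expect_sub hc1 hc2]
  have h2 := expect_condUtility Γ σ hM he i (Function.update (liftInl W σ) i ν)
  rw [Function.update_self] at h2
  rw [← h2]
  congr 1
  funext θ a
  ring

lemma isNash_extGame (hσ : Γ.IsNash σ) :
    (Γ.extGame σ he M).IsNash (liftInl W σ) := by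
  intro i ν
  rw [expectedUtility_update_liftInl Γ σ hM he, expectedUtility_liftInl]
  exact hσ i _

end Expected

section Gains

/-! ### Gains over the equilibrium -/

lemma sum_le_sum_of_forall_ne_le {ι : Type*} [DecidableEq ι] {S : Finset ι} (hS : 2 ≤ S.card)
    {y x : ι → ℝ} (h : ∀ i ∈ S, ∀ k ∈ S, i ≠ k → y i ≤ x k) :
    ∑ i ∈ S, y i ≤ ∑ i ∈ S, x i := by
  have h1 : ∀ k ∈ S, ∑ i ∈ S, y i - y k ≤ ((S.card : ℝ) - 1) * x k := fun k hk => by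
    have := Finset.sum_le_card_nsmul (S.erase k) y (x k) fun i hi =>
      h i (Finset.mem_of_mem_erase hi) k hk (Finset.ne_of_mem_erase hi)
    rw [Finset.sum_erase_eq_sub hk, Finset.card_erase_of_mem hk, nsmul_eq_mul,
      Nat.cast_sub (by omega), Nat.cast_one] at this
    exact this
  have h2 := Finset.sum_le_sum h1
  rw [Finset.sum_sub_distrib, Finset.sum_const, nsmul_eq_mul, ← Finset.mul_sum] at h2
  have h3 : (2 : ℝ) ≤ S.card := by exact_mod_cast hS
  refine le_of_mul_le_mul_left (a := (S.card : ℝ) - 1) ?_ (by linarith)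
  linarith

variable {P : Type v} [Fintype P] [DecidableEq P] {T : P → Type w} {A : P → Type u}
  [∀ i, MeasurableSpace (A i)] {W : Type u} [MeasurableSpace W]
  (Γ : BayesianGame P T A) {σ : Γ.Profile} (hσ : Γ.IsNash σ) {M : ℝ}
  (hM : ∀ i t a, |Γ.utility i t a| ≤ M) (e : W ≃ᵐ ∀ j, A j) (d : ∀ j, A j)
  (ρ : ∀ j, T j → ProbabilityMeasure (A j ⊕ W))

/-- The probability that player `i` plays a new action. -/
noncomputable def newProb (i : P) : ℝ :=
  expect Γ.prior ρ fun _ a => isNew (a i)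

/-- The probability that some opponent of player `i` plays a new action. -/
noncomputable def othersNewProb (i : P) : ℝ :=
  expect Γ.prior ρ fun _ a => othersNew i a

omit [Fintype P] [DecidableEq P] in
lemma isAdmissible_isNew (i : P) :
    IsAdmissible fun (_ : ∀ j, T j) (a : ∀ j, A j ⊕ W) => isNew (a i) :=
  ⟨fun _ => measurable_isNew.comp (measurable_pi_apply i), 1, fun _ _ => abs_isNew_le _⟩

omit [DecidableEq P] in
lemma isAdmissible_othersNew (i : P) :
    IsAdmissible fun (_ : ∀ j, T j) (a : ∀ j, A j ⊕ W) => othersNew i a :=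
  ⟨fun _ => measurable_othersNew i, 1, fun _ a => abs_othersNew_le i a⟩

omit [DecidableEq P] in
lemma newProb_le_othersNewProb {i k : P} (h : i ≠ k) :
    Γ.newProb ρ i ≤ Γ.othersNewProb ρ k :=
  expect_mono (isAdmissible_isNew i) (isAdmissible_othersNew k) fun _ a =>
    isNew_le_othersNew h a

include hσ hM d

/-- A player who cannot profit from a deviation exceeds its equilibrium utility only as far as
it plays new actions more often than its opponents do. -/
lemma expectedUtility_le_add (i : P)
    (hbest : ∀ τ' : T i → ProbabilityMeasure (A i ⊕ W),
      (Γ.extGame σ e.measurable M).expectedUtility (Function.update ρ i τ') i ≤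
        (Γ.extGame σ e.measurable M).expectedUtility ρ i) :
    (Γ.extGame σ e.measurable M).expectedUtility ρ i ≤
      Γ.expectedUtility σ i + 4 * M * (Γ.newProb ρ i - Γ.othersNewProb ρ i) := by
  have hU := isAdmissible_extUtility Γ σ hM e.measurable i
  have hc := isAdmissible_condUtility_proj Γ σ hM e.measurable i
  have hn := isAdmissible_isNew (T := T) (A := A) (W := W) i
  have ho := isAdmissible_othersNew (T := T) (A := A) (W := W) i
  have hU' : IsAdmissible fun (θ : ∀ j, T j) (a : ∀ j, A j ⊕ W) =>
      Γ.extUtility σ e M i (θ i) (Function.update a i (toNew e d i (a i))) :=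
    ⟨fun θ => (hU.1 θ).comp (measurable_update'.comp (measurable_id.prodMk
      ((measurable_toNew e d i).comp (measurable_pi_apply i)))), 5 * M,
      fun θ a => Γ.abs_extUtility_le σ e hM i (θ i) _⟩
  have h1 := expect_mono (q := Γ.prior) (τ := ρ) hU
    ((hc.add (hU'.sub hU)).add ((hn.sub ho).const_mul (4 * M)))
    fun θ a => Γ.extUtility_le σ e d hM i (θ i) a
  rw [expect_add (hc.add (hU'.sub hU)) ((hn.sub ho).const_mul (4 * M)),
    expect_add hc (hU'.sub hU), expect_sub hU' hU, expect_const_mul, expect_sub hn ho,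
    expect_condUtility Γ σ hM e.measurable] at h1
  have h2 := expect_update_map (q := Γ.prior) (τ := ρ) hU i (measurable_toNew e d i)
  have h3 := hbest fun t => (ρ i t).map (measurable_toNew e d i).aemeasurable
  have h4 := hσ i (projStrategy e.measurable i (ρ i))
  change expect Γ.prior _ (fun θ a => Γ.extUtility σ e M i (θ i) a) ≤
    expect Γ.prior ρ (fun θ a => Γ.extUtility σ e M i (θ i) a) at h3
  rw [h2] at h3
  change expect Γ.prior ρ (fun θ a => Γ.extUtility σ e M i (θ i) a) ≤ _
  unfold newProb othersNewProb
  linarith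

/-- If no member of a coalition of at least two players can profit from a deviation, then the total
utility of the coalition is at most its equilibrium utility: nobody can play new actions more often
than the opponents of everybody else do. -/
lemma sum_expectedUtility_le (hM0 : 0 ≤ M) {S : Finset P} (hS : 2 ≤ S.card)
    (hbest : ∀ i ∈ S, ∀ τ' : T i → ProbabilityMeasure (A i ⊕ W),
      (Γ.extGame σ e.measurable M).expectedUtility (Function.update ρ i τ') i ≤
        (Γ.extGame σ e.measurable M).expectedUtility ρ i) :
    ∑ i ∈ S, (Γ.extGame σ e.measurable M).expectedUtility ρ i ≤
      ∑ i ∈ S, Γ.expectedUtility σ i := by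
  have h1 := Finset.sum_le_sum fun i hi =>
    expectedUtility_le_add Γ hσ hM e d ρ i (hbest i hi)
  rw [Finset.sum_add_distrib, ← Finset.mul_sum, Finset.sum_sub_distrib] at h1
  have h2 := sum_le_sum_of_forall_ne_le hS (y := Γ.newProb ρ) (x := Γ.othersNewProb ρ)
    fun i _ k _ h => Γ.newProb_le_othersNewProb ρ h
  nlinarith

lemma isSemiStrongNash_extGame (hM0 : 0 ≤ M) :
    (Γ.extGame σ e.measurable M).IsSemiStrongNash (liftInl W σ) := by
  intro S hne τ
  by_contra! hcon
  have hbest : ∀ i ∈ S, ∀ τ' : T i → ProbabilityMeasure (A i ⊕ W),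
      (Γ.extGame σ e.measurable M).expectedUtility
        (Function.update (S.piecewise τ (liftInl W σ)) i τ') i ≤
      (Γ.extGame σ e.measurable M).expectedUtility (S.piecewise τ (liftInl W σ)) i :=
    fun i hi τ' => (hcon i hi τ').2
  have hgain : ∀ i ∈ S, (Γ.extGame σ e.measurable M).expectedUtility (liftInl W σ) i <
      (Γ.extGame σ e.measurable M).expectedUtility (S.piecewise τ (liftInl W σ)) i :=
    fun i hi => (hcon i hi (τ i)).1
  rcases Nat.lt_or_ge S.card 2 with hS | hS
  · obtain ⟨i, rfl⟩ := Finset.card_eq_one.1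
      (le_antisymm (Nat.lt_succ_iff.1 hS) (Finset.card_pos.2 hne))
    have h := hgain i (Finset.mem_singleton_self i)
    rw [Finset.piecewise_singleton] at h
    exact h.not_ge (isNash_extGame Γ σ hM e.measurable hσ i (τ i))
  · have h1 := Finset.sum_lt_sum_of_nonempty hne hgain
    simp only [expectedUtility_liftInl] at h1
    exact h1.not_ge (sum_expectedUtility_le Γ hσ hM e d _ hM0 hS hbest)

end Gains

end BayesianGame

open BayesianGame in
theorem theorem2 {P : Type v} [Fintype P] [DecidableEq P] {T : P → Type w} {A : P → Type u}
    [∀ i, MeasurableSpace (A i)] (Γ : BayesianGame P T A) (hΓ : Γ.IsBounded)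
    (σ : Γ.Profile) (hσ : Γ.IsNash σ) :
    ∃ E : Γ.Extension,
      E.game.IsBounded ∧
      E.game.IsNash (E.lift σ) ∧
      E.game.IsSemiStrongNash (E.lift σ) ∧
      (∀ τ : E.game.Profile, E.game.IsNash τ →
        E.game.QuasiParetoDominates (E.lift σ) τ) ∧
      (Finite (∀ i, A i) →
        (∀ i, Nat.card (E.Action i) = Nat.card (A i) + Nat.card (∀ j, A j)) ∧
        ((∀ i, MeasurableSingletonClass (A i)) →
          ∀ i, MeasurableSingletonClass (E.Action i))) := by
  choose N hN using hΓ
  let M : ℝ := ∑ i, |N i|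
  have hM0 : 0 ≤ M := Finset.sum_nonneg fun i _ => abs_nonneg _
  have hM : ∀ i t a, |Γ.utility i t a| ≤ M := fun i t a =>
    (hN i t a).trans ((le_abs_self _).trans
      (Finset.single_le_sum (fun i _ => abs_nonneg (N i)) (Finset.mem_univ i)))
  -- The type profile is nonempty as it carries a distribution, and `σ` then provides actions.
  obtain ⟨θ, -⟩ := Γ.prior.support_nonempty
  have hne : ∀ j, Nonempty (A j) := fun j => (σ j (θ j)).nonempty
  let d : ∀ j, A j := fun j => (hne j).some
  -- Action profiles live in `Type (max u v)`; since `P` is finite they have a copy in `Type u`.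
  let W : Type u := Shrink.{u} (∀ j, A j)
  let _ : MeasurableSpace W := MeasurableSpace.comap (equivShrink _).symm inferInstance
  let e : W ≃ᵐ ∀ j, A j :=
    { toEquiv := (equivShrink _).symm
      measurable_toFun := comap_measurable _
      measurable_invFun := by
        rintro _ ⟨s, hs, rfl⟩
        simpa [Set.preimage_preimage] using hs }
  refine ⟨{ Action := fun i => A i ⊕ W
            game := Γ.extGame σ e.measurable M
            embed := fun i => Sum.inl
            measurableEmbedding_embed := fun i =>
              ⟨Sum.inl_injective, measurable_inl, fun _ hs => measurableSet_inl_image.2 hs⟩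
            prior_eq := rfl
            utility_embed := fun i t a => Γ.extUtility_inl σ e M i t a },
    fun i => ⟨5 * M, fun t a => Γ.abs_extUtility_le σ e hM i t a⟩,
    isNash_extGame Γ σ hM e.measurable hσ, isSemiStrongNash_extGame Γ hσ hM e d hM0,
    fun τ hτ S hS => ?_, fun hfin => ⟨fun i => ?_, fun hA i => ?_⟩⟩
  · have h := sum_expectedUtility_le Γ hσ hM e d τ hM0 hS fun i _ => hτ i
    simp only [← expectedUtility_liftInl Γ σ (M := M) e.measurable] at h
    exact h
  · have : Finite W := Finite.of_equiv _ e.toEquiv.symm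
    have : Finite (A i) := Finite.of_surjective (fun a : ∀ j, A j => a i)
      (Function.surjective_eval i)
    exact Nat.card_sum.trans (congrArg _ (Nat.card_congr e.toEquiv))
  · have hW : ∀ w : W, MeasurableSet {w} := fun w => by
      have := e.measurable (measurableSet_singleton (e w))
      rwa [← Set.image_singleton, Set.preimage_image_eq _ e.injective] at this
    refine ⟨fun x => ?_⟩
    rcases x with x | w
    · rw [← Set.image_singleton]
      exact measurableSet_inl_image.2 (measurableSet_singleton x)
    · rw [← Set.image_singleton]
      exact measurableSet_inr_image.2 (hW w)
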